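/- Let $C_{ij}{}^k=C_{ji}{}^k\in\mathbb{R}$ ($i,j,k\in\{1,2\}$), let $M$ be a non-empty connected open subset of $\mathbb{R}^+\times\mathbb{R}=\{(x^1,x^2):x^1>0\}$ (for example $M=\mathbb{R}^+\times\mathbb{R}$), and let $\mathcal{M}=(M,\nabla)$ be the Type $\mathcal{B}$ surface with Christoffel symbols $\Gamma_{ij}{}^k=(x^1)^{-1}C_{ij}{}^k$. Let $\rho(x,y)=\operatorname{Tr}\{z\mapsto R(z,x)y\}$ be the Ricci tensor of $\nabla$, where $R(x,y)=\nabla_x\nabla_y-\nabla_y\nabla_x-\nabla_{[x,y]}$, let $\rho_s(x,y)=\frac12(\rho(x,y)+\rho(y,x))$, and let $$E(\mu,\nabla)=\{f\in C^\infty(M):\ \partial_{x^i}\partial_{x^j}f-\Gamma_{ij}{}^k\,\partial_{x^k}f=\mu f\,(\rho_s)_{ij}\ \text{ for all } i,j\}.$$ Suppose that $\rho$ does not vanish identically and that $\mathcal{M}$ is not strongly projectively flat, i.e. there are no smooth closed $1$-form $\omega$ and flat torsion-free connection $\tilde\nabla$ on $M$ with $\nabla_XY=\tilde\nabla_XY+\omega(X)Y+\omega(Y)X$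 for all $X,Y$. Call two systems of constants $C,\tilde C$ linearly equivalent if some map $(x^1,x^2)\mapsto(x^1,ax^1+bx^2)$ with $a,b\in\mathbb{R}$, $b\ne0$, intertwines the connections on $\mathbb{R}^+\times\mathbb{R}$ that they define. Then $\dim E(-1,\nabla)=1$ if $C$ is linearly equivalent to a system of constants $\tilde C$ which satisfies one of the following conditions, and $\dim E(-1,\nabla)=0$ otherwise: 1. $\tilde C_{22}{}^1=0$ and $\tilde C_{22}{}^2=\tilde C_{12}{}^1\neq0$; 2. for a sign $\varepsilon\in\{1,-1\}$: $\tilde C_{22}{}^1=\varepsilon$, $\tilde C_{12}{}^1=0$, $\tilde C_{22}{}^2=2\varepsilon\,\tilde C_{11}{}^2\neq0$, and $\tilde C_{11}{}^1=1+2\tilde C_{12}{}^2+\varepsilon(\tilde C_{11}{}^2)^2$. -/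

import Mathlib

open scoped ContDiff

noncomputable section

namespace AffineSurface

/-- The coordinate plane; `p 0` is the coordinate `x^1` and `p 1` is the coordinate `x^2`. -/
abbrev Plane : Type := Fin 2 → ℝ

/-- The partial derivative `∂_{x^i} f` at `p`. -/
def partialDeriv (i : Fin 2) (f : Plane → ℝ) (p : Plane) : ℝ :=
  fderiv ℝ f p (Pi.single i 1)

/-- A smooth torsion-free connection on the open set `U`, given in the coordinates `(x^1, x^2)`
by its Christoffel symbols: `∇_{∂_i} ∂_j = ∑ k, Γ i j k • ∂_k`.
Only the values on `U` are meaningful. -/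
structure Connection (U : TopologicalSpace.Opens Plane) where
  /-- `Γ i j k` is the Christoffel symbol `Γ_{ij}{}^k`. -/
  Γ : Fin 2 → Fin 2 → Fin 2 → Plane → ℝ
  smooth : ∀ i j k, ContDiffOn ℝ ∞ (Γ i j k) U
  symm : ∀ i j k, ∀ p ∈ U, Γ i j k p = Γ j i k p

namespace Connection

variable {U : TopologicalSpace.Opens Plane}

/-- The curvature components: `R(∂_i, ∂_j) ∂_k = ∑ l, R_{ijk}{}^l • ∂_l`, where
`R(x, y) = ∇_x ∇_y - ∇_y ∇_x - ∇_{[x, y]}`. -/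
def curvature (D : Connection U) (i j k l : Fin 2) (p : Plane) : ℝ :=
  partialDeriv i (D.Γ j k l) p - partialDeriv j (D.Γ i k l) p
    + ∑ m, (D.Γ j k m p * D.Γ i m l p - D.Γ i k m p * D.Γ j m l p)

/-- The Ricci tensor `ρ(x, y) = Tr (z ↦ R(z, x) y)`. -/
def ricci (D : Connection U) (j k : Fin 2) (p : Plane) : ℝ :=
  ∑ i, D.curvature i j k i p

/-- The symmetrized Ricci tensor `ρ_s`. -/
def ricciSym (D : Connection U) (j k : Fin 2) (p : Plane) : ℝ :=
  (D.ricci j k p + D.ricci k j p) / 2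

/-- The Ricci tensor does not vanish identically on `U`. -/
def RicciNeZero (D : Connection U) : Prop :=
  ∃ p ∈ U, ∃ j k, D.ricci j k p ≠ 0

/-- The curvature vanishes identically on `U`. -/
def IsFlat (D : Connection U) : Prop :=
  ∀ p ∈ U, ∀ i j k l, D.curvature i j k l p = 0

/-- `D` and `D'` are strongly projectively equivalent: there is a smooth closed 1-form `η` on `U`
with `∇_X Y = ∇'_X Y + η(X) Y + η(Y) X`. -/
def StronglyProjectivelyEquivalent (D D' : Connection U) : Prop :=
  ∃ η : Fin 2 → Plane → ℝ,
    (∀ i, ContDiffOn ℝ ∞ (η i) U) ∧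
    (∀ p ∈ U, ∀ i j, partialDeriv i (η j) p = partialDeriv j (η i) p) ∧
    (∀ p ∈ U, ∀ i j k, D.Γ i j k p = D'.Γ i j k p
      + (if j = k then η i p else 0) + (if i = k then η j p else 0))

/-- `D` is strongly projectively equivalent to a flat torsion-free connection on `U`. -/
def StronglyProjectivelyFlat (D : Connection U) : Prop :=
  ∃ D' : Connection U, D'.IsFlat ∧ D.StronglyProjectivelyEquivalent D'

/-- The Hessian `(H f)_{ij} = ∂_i ∂_j f - ∑ k, Γ_{ij}{}^k ∂_k f`. -/
def hessian (D : Connection U) (f : Plane → ℝ) (i j : Fin 2) (p : Plane) : ℝ :=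
  partialDeriv i (partialDeriv j f) p - ∑ k, D.Γ i j k p * partialDeriv k f p

end Connection

open Classical in
/-- Extension by zero of a function on `U`, used only to speak about its derivatives on `U`. -/
def extendZero {U : TopologicalSpace.Opens Plane} (f : U → ℝ) (p : Plane) : ℝ :=
  if h : p ∈ U then f ⟨p, h⟩ else 0

theorem partialDeriv_add {f g : Plane → ℝ} {p : Plane} (i : Fin 2)
    (hf : DifferentiableAt ℝ f p) (hg : DifferentiableAt ℝ g p) :
    partialDeriv i (f + g) p = partialDeriv i f p + partialDeriv i g p := by
  simp [partialDeriv, fderiv_add hf hg]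

theorem partialDeriv_smul {f : Plane → ℝ} {p : Plane} (i : Fin 2) (c : ℝ)
    (hf : DifferentiableAt ℝ f p) :
    partialDeriv i (c • f) p = c * partialDeriv i f p := by
  simp [partialDeriv, fderiv_const_smul hf c]

theorem differentiableAt_of_smooth {U : TopologicalSpace.Opens Plane} {f : Plane → ℝ}
    (hf : ContDiffOn ℝ ∞ f U) {p : Plane} (hp : p ∈ U) : DifferentiableAt ℝ f p :=
  (hf.contDiffAt (U.isOpen.mem_nhds hp)).differentiableAt (by simp)

theorem smooth_partialDeriv {U : TopologicalSpace.Opens Plane} {f : Plane → ℝ}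
    (hf : ContDiffOn ℝ ∞ f U) (i : Fin 2) : ContDiffOn ℝ ∞ (partialDeriv i f) U :=
  (hf.fderiv_of_isOpen (m := ∞) U.isOpen (by simp)).clm_apply contDiffOn_const

theorem partialDeriv_congr {U : TopologicalSpace.Opens Plane} {f g : Plane → ℝ}
    (h : ∀ q ∈ U, f q = g q) (i : Fin 2) {p : Plane} (hp : p ∈ U) :
    partialDeriv i f p = partialDeriv i g p := by
  have : f =ᶠ[nhds p] g := Filter.eventually_of_mem (U.isOpen.mem_nhds hp) h
  simp [partialDeriv, this.fderiv_eq]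

theorem extendZero_add {U : TopologicalSpace.Opens Plane} (f g : U → ℝ) :
    extendZero (f + g) = extendZero f + extendZero g := by
  funext p
  by_cases h : p ∈ U <;> simp [extendZero, h]

theorem extendZero_smul {U : TopologicalSpace.Opens Plane} (c : ℝ) (f : U → ℝ) :
    extendZero (c • f) = c • extendZero f := by
  funext p
  by_cases h : p ∈ U <;> simp [extendZero, h]

namespace Connection

variable {U : TopologicalSpace.Opens Plane}

theorem hessian_add (D : Connection U) {f g : Plane → ℝ} (hf : ContDiffOn ℝ ∞ f U)
    (hg : ContDiffOn ℝ ∞ g U) (i j : Fin 2) {p : Plane} (hp : p ∈ U) :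
    D.hessian (f + g) i j p = D.hessian f i j p + D.hessian g i j p := by
  have h2 : partialDeriv i (partialDeriv j (f + g)) p
      = partialDeriv i (partialDeriv j f) p + partialDeriv i (partialDeriv j g) p := by
    rw [partialDeriv_congr (g := partialDeriv j f + partialDeriv j g) (fun q hq =>
      partialDeriv_add j (differentiableAt_of_smooth hf hq) (differentiableAt_of_smooth hg hq))
      i hp]
    exact partialDeriv_add i (differentiableAt_of_smooth (smooth_partialDeriv hf j) hp)
      (differentiableAt_of_smooth (smooth_partialDeriv hg j) hp)
  simp only [hessian, h2, Fin.sum_univ_two, partialDeriv_add _ (differentiableAt_of_smooth hf hp)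
    (differentiableAt_of_smooth hg hp)]
  ring

theorem hessian_smul (D : Connection U) {f : Plane → ℝ} (hf : ContDiffOn ℝ ∞ f U)
    (c : ℝ) (i j : Fin 2) {p : Plane} (hp : p ∈ U) :
    D.hessian (c • f) i j p = c * D.hessian f i j p := by
  have h2 : partialDeriv i (partialDeriv j (c • f)) p
      = c * partialDeriv i (partialDeriv j f) p := by
    rw [partialDeriv_congr (g := c • partialDeriv j f) (fun q hq =>
      partialDeriv_smul j c (differentiableAt_of_smooth hf hq)) i hp]
    exact partialDeriv_smul i c (differentiableAt_of_smooth (smooth_partialDeriv hf j) hp)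
  simp only [hessian, h2, Fin.sum_univ_two, partialDeriv_smul _ c
    (differentiableAt_of_smooth hf hp)]
  ring

/-- `E(μ, ∇)`: the real vector space of smooth functions `f` on `U` that solve the affine
quasi-Einstein equation `H f = μ f ρ_s`. -/
def E (D : Connection U) (μ : ℝ) : Submodule ℝ (U → ℝ) where
  carrier := {f | ContDiffOn ℝ ∞ (extendZero f) U ∧
    ∀ p ∈ U, ∀ i j, D.hessian (extendZero f) i j p = μ * extendZero f p * D.ricciSym i j p}
  zero_mem' := by
    have h0 : extendZero (0 : U → ℝ) = fun _ => 0 := by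
      funext p
      simp [extendZero]
    refine ⟨by rw [h0]; exact contDiffOn_const, fun p _ i j => ?_⟩
    have h1 : ∀ k, partialDeriv k (fun _ : Plane => (0 : ℝ)) = fun _ => 0 := by
      intro k
      funext q
      simp [partialDeriv]
    simp [hessian, h0, h1]
  add_mem' := by
    rintro f g ⟨hf, hf'⟩ ⟨hg, hg'⟩
    refine ⟨by rw [extendZero_add]; exact hf.add hg, fun p hp i j => ?_⟩
    rw [extendZero_add, D.hessian_add hf hg i j hp, hf' p hp i j, hg' p hp i j, Pi.add_apply]
    ring
  smul_mem' := by
    rintro c f ⟨hf, hf'⟩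
    refine ⟨by rw [extendZero_smul]; exact contDiffOn_const.smul hf, fun p hp i j => ?_⟩
    rw [extendZero_smul, D.hessian_smul hf c i j hp, hf' p hp i j, Pi.smul_apply, smul_eq_mul]
    ring

end Connection

/-- The open half plane `ℝ⁺ × ℝ`, i.e. `x^1 > 0`. -/
def halfPlane : TopologicalSpace.Opens Plane :=
  ⟨{p | 0 < p 0}, isOpen_lt continuous_const (continuous_apply 0)⟩

/-- The constants of a Type B surface: `C i j k` stands for `C_{ij}{}^k = C_{ji}{}^k`, where the
indices `0, 1 : Fin 2` stand for `1, 2`. -/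
structure TypeBConstants where
  C : Fin 2 → Fin 2 → Fin 2 → ℝ
  symm : ∀ i j k, C i j k = C j i k

namespace TypeBConstants

/-- The connection `∇^C` with `Γ_{ij}{}^k = C_{ij}{}^k / x^1`, on an open subset `U` of the half
plane `x^1 > 0`. -/
def connection (c : TypeBConstants) (U : TopologicalSpace.Opens Plane) (hU : U ≤ halfPlane) :
    Connection U where
  Γ i j k p := (p 0)⁻¹ * c.C i j k
  smooth i j k := by
    refine ContDiffOn.mul (ContDiffOn.inv ?_ fun p hp => ne_of_gt (hU hp)) contDiffOn_const
    exact (contDiff_apply ℝ ℝ (0 : Fin 2)).contDiffOn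
  symm i j k p _ := by rw [c.symm]

/-- Linear equivalence of the Type B surfaces with constants `c` and `c'`: some linear map
`(x^1, x^2) ↦ (x^1, a x^1 + b x^2)`, `b ≠ 0`, of the half plane onto itself intertwines the two
connections, `dA (∇_{∂_i} ∂_j) = ∇'_{dA ∂_i} (dA ∂_j)`. (As `A` is linear, it is its own
Jacobian matrix and no second derivatives of it occur.) -/
def LinearlyEquivalent (c c' : TypeBConstants) : Prop :=
  ∃ a b : ℝ, b ≠ 0 ∧ ∃ A : Matrix (Fin 2) (Fin 2) ℝ, A = !![1, 0; a, b] ∧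
    ∀ p ∈ halfPlane, ∀ i j k,
      ∑ l, A k l * (c.connection halfPlane le_rfl).Γ i j l p
        = ∑ m, ∑ n, A m i * A n j * (c'.connection halfPlane le_rfl).Γ m n k (A.mulVec p)

/-- `C_{22}{}^1 = 0`, `C_{22}{}^2 = C_{12}{}^1 ≠ 0`. -/
def FamilyOne (c : TypeBConstants) : Prop :=
  c.C 1 1 0 = 0 ∧ c.C 1 1 1 = c.C 0 1 0 ∧ c.C 0 1 0 ≠ 0

/-- `C_{22}{}^1 = ε`, `C_{12}{}^1 = 0`, `C_{22}{}^2 = 2 ε C_{11}{}^2 ≠ 0`,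
`C_{11}{}^1 = 1 + 2 C_{12}{}^2 + ε (C_{11}{}^2)^2` for a sign `ε = ±1`. -/
def FamilyTwo (c : TypeBConstants) : Prop :=
  ∃ ε : ℝ, (ε = 1 ∨ ε = -1) ∧ c.C 1 1 0 = ε ∧ c.C 0 1 0 = 0 ∧
    c.C 1 1 1 = 2 * ε * c.C 0 0 1 ∧ c.C 1 1 1 ≠ 0 ∧
    c.C 0 0 0 = 1 + 2 * c.C 0 1 1 + ε * (c.C 0 0 1) ^ 2

/-- Linearly equivalent to a member of one of the two exceptional families. -/
def IsExceptional (c : TypeBConstants) : Prop :=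
  ∃ c' : TypeBConstants, c.LinearlyEquivalent c' ∧ (c'.FamilyOne ∨ c'.FamilyTwo)

end TypeBConstants

end AffineSurface

end

/-!
Write `Γ_{ij}{}^k = C_{ij}{}^k / x^1`. All curvature quantities are then constants divided by powers
of `x^1`, and `w = C_{12}{}^1 + C_{22}{}^2` is, up to a nonzero factor, the skew part of the Ricci
tensor.

Differentiating the equation `Hess f = -f ρ_s` once more and commuting derivatives, the value
`μ = -1` makes the symmetric part of `ρ` drop out of the curvature term, which leaves
`(w / 2) x^1 ∂_i f = T_i f`, where `T` is the Codazzi defect of `ρ_s`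
(`IsSolutionOn.skew_mul_partialDeriv`). There are two cases.

* If `w = 0`, a nonzero solution forces `T = 0`. Then some power `(x^1)^a` solves the equation
  (`exists_isPowerExponent`), and subtracting the closed form `d log (x^1)^a` from the connection
  makes it flat (`stronglyProjectivelyFlat_of_isPowerExponent`). So if the surface is not strongly
  projectively flat, there are no nonzero solutions.
* If `w ≠ 0`, then `∂_i f = a_i f / x^1` with constants `a_i` that do not depend on `f`, and
  closedness of `d log f` forces `a_2 = 0` (`IsSolutionOn.isPowerExponent`). So the solution space is
  either zero or spanned by a single power `(x^1)^a`.

It remains to decide for which constants with `w ≠ 0` some power solves the equation. This is a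
system of three polynomial equations, invariant under linear equivalence
(`isPowerExponent_iff_of_forall`). If `C_{22}{}^1 = 0` it amounts to the first exceptional family;
otherwise a shear and a rescaling achieve `C_{12}{}^1 = 0` and `C_{22}{}^1 = ±1`, and it amounts to
the second (`isExceptional_of_isPowerExponent`, `IsExceptional.exists_isPowerExponent`).
-/

noncomputable section

namespace AffineSurface

/-! ### Curvature of a Type B connection -/

theorem partialDeriv_mul {f g : Plane → ℝ} {p : Plane} (i : Fin 2)
    (hf : DifferentiableAt ℝ f p) (hg : DifferentiableAt ℝ g p) :
    partialDeriv i (fun q => f q * g q) p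
      = partialDeriv i f p * g p + f p * partialDeriv i g p := by
  simp [partialDeriv, fderiv_fun_mul hf hg]
  ring

theorem hasFDerivAt_coord_zero (p : Plane) :
    HasFDerivAt (fun q : Plane => q 0) (ContinuousLinearMap.proj (R := ℝ) 0) p :=
  (ContinuousLinearMap.proj (R := ℝ) (φ := fun _ : Fin 2 => ℝ) 0).hasFDerivAt

theorem partialDeriv_comp_coord_zero {φ : ℝ → ℝ} {φ' : ℝ} {p : Plane} (h : HasDerivAt φ φ' (p 0))
    (i : Fin 2) : partialDeriv i (fun q => φ (q 0)) p = if i = 0 then φ' else 0 := by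
  have := (h.comp_hasFDerivAt p (hasFDerivAt_coord_zero p)).fderiv
  simp only [Function.comp_def] at this
  fin_cases i <;> simp [partialDeriv, this]

theorem differentiableAt_comp_coord_zero {φ : ℝ → ℝ} {φ' : ℝ} {p : Plane}
    (h : HasDerivAt φ φ' (p 0)) : DifferentiableAt ℝ (fun q : Plane => φ (q 0)) p :=
  (h.comp_hasFDerivAt p (hasFDerivAt_coord_zero p)).differentiableAt

theorem partialDeriv_comm {U : TopologicalSpace.Opens Plane} {f : Plane → ℝ}
    (hf : ContDiffOn ℝ ∞ f U) {p : Plane} (hp : p ∈ U) (i j : Fin 2) :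
    partialDeriv i (partialDeriv j f) p = partialDeriv j (partialDeriv i f) p := by
  have hc : ContDiffAt ℝ ∞ f p := hf.contDiffAt (U.isOpen.mem_nhds hp)
  have hs : IsSymmSndFDerivAt ℝ f p := (contDiffAt_infty.1 hc 2).isSymmSndFDerivAt (by simp)
  have hd : DifferentiableAt ℝ (fderiv ℝ f) p :=
    (hc.fderiv_right (m := 1) (by norm_cast)).differentiableAt (by simp)
  have key : ∀ i j : Fin 2, partialDeriv i (partialDeriv j f) p
      = fderiv ℝ (fderiv ℝ f) p (Pi.single i 1) (Pi.single j 1) := by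
    intro i j
    unfold partialDeriv
    rw [fderiv_clm_apply hd (differentiableAt_const _)]
    simp
  rw [key, key]
  exact hs.eq _ _

namespace TypeBConstants

/-- The constants `(x^1)^2 R_{ijk}{}^l` of the Type B connection; the first two terms come from
`∂_1 (1 / x^1) = -1 / (x^1)^2`. -/
def curvatureConst (c : TypeBConstants) (i j k l : Fin 2) : ℝ :=
  (if i = 0 then -c.C j k l else 0) - (if j = 0 then -c.C i k l else 0)
    + ∑ m, (c.C j k m * c.C i m l - c.C i k m * c.C j m l)

/-- The constants `(x^1)^2 (ρ_s)_{jk}` of the Type B connection. -/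
def ricciSymConst (c : TypeBConstants) (j k : Fin 2) : ℝ :=
  (∑ i, c.curvatureConst i j k i + ∑ i, c.curvatureConst i k j i) / 2

theorem hasDerivAt_inv_mul_const {x : ℝ} (hx : x ≠ 0) (C : ℝ) :
    HasDerivAt (fun y : ℝ => y⁻¹ * C) (-C * (x ^ 2)⁻¹) x :=
  ((hasDerivAt_inv hx).mul_const C).congr_deriv (by ring)

variable (c : TypeBConstants) (U : TopologicalSpace.Opens Plane) (hU : U ≤ halfPlane)

theorem curvature_connection {p : Plane} (hp : p ∈ U) (i j k l : Fin 2) :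
    (c.connection U hU).curvature i j k l p = (p 0 ^ 2)⁻¹ * c.curvatureConst i j k l := by
  have hx : p 0 ≠ 0 := ne_of_gt (hU hp)
  have h := fun (C : ℝ) (i : Fin 2) =>
    partialDeriv_comp_coord_zero (hasDerivAt_inv_mul_const hx C) i
  simp only [Connection.curvature, connection, h, curvatureConst, Fin.sum_univ_two]
  split_ifs <;> field_simp <;> ring

theorem ricciSym_connection {p : Plane} (hp : p ∈ U) (j k : Fin 2) :
    (c.connection U hU).ricciSym j k p = (p 0 ^ 2)⁻¹ * c.ricciSymConst j k := by
  simp only [Connection.ricciSym, Connection.ricci, curvature_connection c U hU hp,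
    ricciSymConst, Fin.sum_univ_two]
  ring

theorem ricciSymConst_zero_zero : c.ricciSymConst 0 0 =
    c.C 0 1 1 * (1 + c.C 0 0 0 - c.C 0 1 1) + c.C 0 0 1 * (c.C 1 1 1 - c.C 0 1 0) := by
  simp [ricciSymConst, curvatureConst, Fin.sum_univ_two, c.symm 1 0]
  ring

theorem ricciSymConst_zero_one : c.ricciSymConst 0 1 =
    c.C 0 1 0 * c.C 0 1 1 - c.C 0 0 1 * c.C 1 1 0 + (c.C 1 1 1 - c.C 0 1 0) / 2 := by
  simp [ricciSymConst, curvatureConst, Fin.sum_univ_two, c.symm 1 0]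
  ring

theorem ricciSymConst_one_one : c.ricciSymConst 1 1 =
    c.C 1 1 0 * (c.C 0 0 0 - c.C 0 1 1 - 1) + c.C 0 1 0 * (c.C 1 1 1 - c.C 0 1 0) := by
  simp [ricciSymConst, curvatureConst, Fin.sum_univ_two, c.symm 1 0]
  ring

theorem ricciSymConst_comm (i j : Fin 2) : c.ricciSymConst i j = c.ricciSymConst j i := by
  simp only [ricciSymConst]
  ring

/-! ### Exponents of power solutions -/

/-- `(x^1)^a` solves the quasi-Einstein equation with `μ = -1`: both sides of its components are
multiples of `(x^1)^(a - 2)`, and the condition compares the coefficients. -/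
def IsPowerExponent (c : TypeBConstants) (a : ℝ) : Prop :=
  ∀ i j, (if i = 0 ∧ j = 0 then a * (a - 1) else 0) - c.C i j 0 * a = -c.ricciSymConst i j

theorem isPowerExponent_iff (c : TypeBConstants) (a : ℝ) : c.IsPowerExponent a ↔
    a * (a - 1) - c.C 0 0 0 * a = -c.ricciSymConst 0 0 ∧
    c.C 0 1 0 * a = c.ricciSymConst 0 1 ∧ c.C 1 1 0 * a = c.ricciSymConst 1 1 := by
  simp [IsPowerExponent, Fin.forall_fin_two, c.symm 1 0, c.ricciSymConst_comm 1 0]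
  tauto

/-- The constants of `∇ - η ⊗ id - id ⊗ η` for the closed form `η = a dx^1 / x^1`. -/
def projectiveShift (c : TypeBConstants) (a : ℝ) : TypeBConstants where
  C i j k := c.C i j k - (if j = k ∧ i = 0 then a else 0) - (if i = k ∧ j = 0 then a else 0)
  symm i j k := by rw [c.symm]; ring

/-- If the Ricci tensor is symmetric and `(x^1)^a` solves the quasi-Einstein equation, then the
shifted connection is flat. -/
theorem curvatureConst_projectiveShift {c : TypeBConstants} {a : ℝ} (ha : c.IsPowerExponent a)
    (hw : c.C 0 1 0 + c.C 1 1 1 = 0) (i j k l : Fin 2) :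
    (c.projectiveShift a).curvatureConst i j k l = 0 := by
  obtain ⟨h0, h1, h2⟩ := (c.isPowerExponent_iff a).1 ha
  rw [ricciSymConst_zero_zero] at h0
  rw [ricciSymConst_zero_one] at h1
  rw [ricciSymConst_one_one] at h2
  have hu : c.C 1 1 1 = -c.C 0 1 0 := by linarith
  rw [hu] at h0 h1 h2
  fin_cases i <;> fin_cases j <;> fin_cases k <;> fin_cases l <;>
    simp [curvatureConst, projectiveShift, Fin.sum_univ_two, c.symm 1 0, hu] <;> grind

theorem stronglyProjectivelyFlat_of_isPowerExponent {c : TypeBConstants} {a : ℝ}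
    (ha : c.IsPowerExponent a) (hw : c.C 0 1 0 + c.C 1 1 1 = 0)
    (U : TopologicalSpace.Opens Plane) (hU : U ≤ halfPlane) :
    (c.connection U hU).StronglyProjectivelyFlat := by
  have hη : ∀ p ∈ U, HasDerivAt (fun y : ℝ => y⁻¹ * a) (-a * (p 0 ^ 2)⁻¹) (p 0) :=
    fun p hp => hasDerivAt_inv_mul_const (ne_of_gt (hU hp)) a
  refine ⟨(c.projectiveShift a).connection U hU, fun p hp i j k l => ?_,
    fun i p => if i = 0 then (p 0)⁻¹ * a else 0, fun i => ?_, fun p hp i j => ?_,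
    fun p hp i j k => ?_⟩
  · rw [curvature_connection _ _ _ hp, curvatureConst_projectiveShift ha hw, mul_zero]
  · fin_cases i
    · refine ContDiffOn.mul (ContDiffOn.inv ?_ fun p hp => ne_of_gt (hU hp)) contDiffOn_const
      exact (contDiff_apply ℝ ℝ (0 : Fin 2)).contDiffOn
    · exact contDiffOn_const
  · have h0 := partialDeriv_comp_coord_zero (hη p hp)
    have h1 : ∀ i, partialDeriv i (fun _ : Plane => (0 : ℝ)) p = 0 := by
      simp [partialDeriv]
    fin_cases i <;> fin_cases j <;> simp [h0, h1]
  · fin_cases i <;> fin_cases j <;> fin_cases k <;>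
      simp [connection, projectiveShift] <;> ring

/-- The constants `(x^1)^3 ((∇_{∂_2} ρ_s)(∂_1, ∂_i) - (∇_{∂_1} ρ_s)(∂_2, ∂_i))`, which measure the
failure of `ρ_s` to be a Codazzi tensor. The terms `Γ_{12}{}^l (ρ_s)_{li}` cancel. -/
def codazziConst (c : TypeBConstants) (i : Fin 2) : ℝ :=
  (if i = 0 then 2 * c.ricciSymConst 0 1 else 2 * c.ricciSymConst 1 1)
    + ∑ l, (c.C 0 i l * c.ricciSymConst 1 l - c.C 1 i l * c.ricciSymConst 0 l)

/-- If the Ricci tensor is symmetric and Codazzi, some power of `x^1` solves the quasi-Einstein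
equation. -/
theorem exists_isPowerExponent {c : TypeBConstants} (hw : c.C 0 1 0 + c.C 1 1 1 = 0)
    (hT : ∀ i, c.codazziConst i = 0) : ∃ a, c.IsPowerExponent a := by
  have hT0 := hT 0
  have hT1 := hT 1
  have hu : c.C 1 1 1 = -c.C 0 1 0 := by linarith
  simp only [codazziConst, Fin.sum_univ_two, c.symm 1 0, c.ricciSymConst_comm 1 0,
    ricciSymConst_zero_zero, ricciSymConst_zero_one, ricciSymConst_one_one, hu, if_true,
    one_ne_zero, if_false] at hT0 hT1
  simp only [isPowerExponent_iff,
    ricciSymConst_zero_zero, ricciSymConst_zero_one, ricciSymConst_one_one, hu]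
  generalize c.C 0 0 0 = p at *
  generalize c.C 0 0 1 = q at *
  generalize c.C 0 1 0 = r at *
  generalize c.C 0 1 1 = s at *
  generalize c.C 1 1 0 = t at *
  by_cases ht : t = 0
  · subst ht
    have hr : r = 0 := by
      have : r ^ 2 = 0 := by linarith
      simpa using this
    subst hr
    exact ⟨s, by ring, by ring, by ring⟩
  · -- With `k = r ^ 2 / t` the Codazzi equations become `p = 2s + 1 + 3k` and `qt + r + rk = 0`.
    obtain ⟨k, hk⟩ : ∃ k, r ^ 2 = k * t := ⟨r ^ 2 / t, by field_simp⟩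
    have hp : p = 2 * s + 1 + 3 * k := by
      apply mul_left_cancel₀ ht
      linarith
    subst hp
    have hq : q * t + r + r * k = 0 := by
      grind
    have hqr : q * r + k + k ^ 2 = 0 := by
      apply mul_left_cancel₀ ht
      grind
    refine ⟨s + k, ?_, ?_, ?_⟩ <;> grind

/-! ### Linear changes of coordinates -/

/-- Linear equivalence is an identity between constants: the map preserves `x^1`, so the factors
`1 / x^1` agree on both sides. -/
theorem linearlyEquivalent_of_forall {c c' : TypeBConstants} {a b : ℝ} (hb : b ≠ 0)
    (h : ∀ i j k, ∑ l, (!![1, 0; a, b] : Matrix (Fin 2) (Fin 2) ℝ) k l * c.C i j l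
      = ∑ m, ∑ n, (!![1, 0; a, b] : Matrix (Fin 2) (Fin 2) ℝ) m i * !![1, 0; a, b] n j
        * c'.C m n k) : c.LinearlyEquivalent c' := by
  refine ⟨a, b, hb, _, rfl, fun p _ i j k => ?_⟩
  have hA : ((!![1, 0; a, b] : Matrix (Fin 2) (Fin 2) ℝ).mulVec p) 0 = p 0 := by
    simp [Matrix.mulVec, dotProduct, Fin.sum_univ_two]
  have := congrArg (fun y => (p 0)⁻¹ * y) (h i j k)
  simp only [connection, hA, Fin.sum_univ_two] at this ⊢
  linarith

theorem LinearlyEquivalent.exists_forall {c c' : TypeBConstants} (h : c.LinearlyEquivalent c') :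
    ∃ a b : ℝ, b ≠ 0 ∧ ∀ i j k, ∑ l, (!![1, 0; a, b] : Matrix (Fin 2) (Fin 2) ℝ) k l * c.C i j l
      = ∑ m, ∑ n, (!![1, 0; a, b] : Matrix (Fin 2) (Fin 2) ℝ) m i * !![1, 0; a, b] n j
        * c'.C m n k := by
  obtain ⟨a, b, hb, A, rfl, h⟩ := h
  refine ⟨a, b, hb, fun i j k => ?_⟩
  have := h (fun _ => 1) (by simp [halfPlane]) i j k
  simpa [connection, Matrix.mulVec, dotProduct, Fin.sum_univ_two] using this

/-- The map `(x^1, x^2) ↦ (x^1, a x^1 + b x^2)` preserves `x^1`, so equivalent constants have the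
same power solutions. -/
theorem isPowerExponent_iff_of_forall {c c' : TypeBConstants} {e a b : ℝ} (hb : b ≠ 0)
    (h : ∀ i j k, ∑ l, (!![1, 0; a, b] : Matrix (Fin 2) (Fin 2) ℝ) k l * c.C i j l
      = ∑ m, ∑ n, (!![1, 0; a, b] : Matrix (Fin 2) (Fin 2) ℝ) m i * !![1, 0; a, b] n j
        * c'.C m n k) : c.IsPowerExponent e ↔ c'.IsPowerExponent e := by
  have h000 := h 0 0 0
  have h010 := h 0 1 0
  have h110 := h 1 1 0
  have h001 := h 0 0 1
  have h011 := h 0 1 1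
  have h111 := h 1 1 1
  simp [Fin.sum_univ_two, c'.symm 1 0] at h000 h010 h110 h001 h011 h111
  rw [isPowerExponent_iff, isPowerExponent_iff]
  simp only [ricciSymConst_zero_zero, ricciSymConst_zero_one, ricciSymConst_one_one]
  generalize c.C 0 0 0 = p at *
  generalize c.C 0 0 1 = q at *
  generalize c.C 0 1 0 = r at *
  generalize c.C 0 1 1 = s at *
  generalize c.C 1 1 0 = t at *
  generalize c.C 1 1 1 = u at *
  generalize c'.C 0 0 0 = p' at *
  generalize c'.C 0 0 1 = q' at *
  generalize c'.C 0 1 0 = r' at *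
  generalize c'.C 0 1 1 = s' at *
  generalize c'.C 1 1 0 = t' at *
  generalize c'.C 1 1 1 = u' at *
  have hu : u = b * u' - a * b * t' := by
    apply mul_left_cancel₀ hb
    linear_combination h111 - a * h110
  have hs : s = s' + a * u' - a * r' - a ^ 2 * t' := by
    apply mul_left_cancel₀ hb
    linear_combination h011 - a * h010
  have hq : q = (q' + 2 * a * s' + a ^ 2 * u' - a * p) / b := by
    field_simp
    linear_combination h001
  have ht : t = b ^ 2 * t' := by linear_combination h110
  have hr : r = b * r' + a * b * t' := by linear_combination h010
  have hp : p = p' + 2 * a * r' + a ^ 2 * t' := by linear_combination h000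
  -- The defects of the three equations transform as the components of a symmetric bilinear form.
  have key : ∀ x y z x' y' z' : ℝ, x = x' + 2 * a * y' + a ^ 2 * z' → y = b * y' + a * b * z' →
      z = b ^ 2 * z' → ((x = 0 ∧ y = 0 ∧ z = 0) ↔ (x' = 0 ∧ y' = 0 ∧ z' = 0)) := by
    rintro x y z x' y' z' rfl rfl rfl
    constructor
    · rintro ⟨hx, hy, hz⟩
      have hz' : z' = 0 := by simpa [hb] using hz
      subst hz'
      have hy' : y' = 0 := by simpa [hb] using hy
      subst hy'
      exact ⟨by linarith, rfl, rfl⟩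
    · rintro ⟨rfl, rfl, rfl⟩
      simp
  have := key (-(e * (e - 1) - p * e) - (s * (1 + p - s) + q * (u - r)))
    (r * e - (r * s - q * t + (u - r) / 2)) (t * e - (t * (p - s - 1) + r * (u - r)))
    (-(e * (e - 1) - p' * e) - (s' * (1 + p' - s') + q' * (u' - r')))
    (r' * e - (r' * s' - q' * t' + (u' - r') / 2)) (t' * e - (t' * (p' - s' - 1) + r' * (u' - r')))
    (by rw [hq, hu, hs, hr, hp]; field_simp; ring)
    (by rw [hq, hu, hs, hr, hp, ht]; field_simp; ring)
    (by rw [hu, hs, hr, hp, ht]; ring)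
  grind

/-- In the normalization `C_{12}{}^1 = 0`, `C_{22}{}^1 = ε`, the `22` equation determines the
exponent, the `12` equation is the condition on `C_{22}{}^2` and the `11` equation the one on
`C_{11}{}^1`. -/
theorem familyTwo_of_isPowerExponent {c : TypeBConstants} {a ε : ℝ} (ha : c.IsPowerExponent a)
    (hε : ε = 1 ∨ ε = -1) (ht : c.C 1 1 0 = ε) (hr : c.C 0 1 0 = 0) (hu : c.C 1 1 1 ≠ 0) :
    c.FamilyTwo := by
  obtain ⟨h0, h1, h2⟩ := (c.isPowerExponent_iff a).1 ha
  rw [ricciSymConst_zero_zero] at h0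
  rw [ricciSymConst_zero_one] at h1
  rw [ricciSymConst_one_one] at h2
  rw [hr] at h0 h1 h2
  rw [ht] at h1 h2
  have hε0 : ε ≠ 0 := by rcases hε with rfl | rfl <;> norm_num
  have hu' : c.C 1 1 1 = 2 * ε * c.C 0 0 1 := by linear_combination -2 * h1
  have ha' : a = c.C 0 0 0 - c.C 0 1 1 - 1 := by
    apply mul_left_cancel₀ hε0
    linear_combination h2
  refine ⟨ε, hε, ht, hr, hu', hu, ?_⟩
  rw [ha', hu'] at h0
  linear_combination -h0 / 2

theorem isExceptional_of_isPowerExponent {c : TypeBConstants} {a : ℝ} (ha : c.IsPowerExponent a)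
    (hw : c.C 0 1 0 + c.C 1 1 1 ≠ 0) : c.IsExceptional := by
  obtain ⟨h0, h1, h2⟩ := (c.isPowerExponent_iff a).1 ha
  rw [ricciSymConst_zero_zero] at h0
  rw [ricciSymConst_zero_one] at h1
  rw [ricciSymConst_one_one] at h2
  by_cases ht : c.C 1 1 0 = 0
  · refine ⟨c, linearlyEquivalent_of_forall (a := 0) (b := 1) one_ne_zero fun i j k => ?_,
      Or.inl ?_⟩
    · fin_cases i <;> fin_cases j <;> fin_cases k <;> simp [Fin.sum_univ_two]
    · rw [ht] at h1 h2
      have hr : c.C 0 1 0 ≠ 0 := by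
        intro hr
        rw [hr] at h1 hw
        apply hw
        linarith
      have hu : c.C 1 1 1 - c.C 0 1 0 = 0 := by
        apply mul_left_cancel₀ hr
        linarith
      exact ⟨ht, by linarith, hr⟩
  · -- A shear makes `C_{12}{}^1` vanish and a rescaling makes `C_{22}{}^1` a sign.
    set b : ℝ := √|c.C 1 1 0| with hb_def
    have hb : b ≠ 0 := (Real.sqrt_pos.2 (abs_pos.2 ht)).ne'
    obtain ⟨ε, hε, hεb⟩ : ∃ ε : ℝ, (ε = 1 ∨ ε = -1) ∧ c.C 1 1 0 = ε * b ^ 2 := by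
      rw [hb_def, Real.sq_sqrt (abs_nonneg _)]
      rcases abs_choice (c.C 1 1 0) with h | h
      · exact ⟨1, Or.inl rfl, by rw [h]; ring⟩
      · exact ⟨-1, Or.inr rfl, by rw [h]; ring⟩
    have hεε : ε * ε = 1 := by rcases hε with rfl | rfl <;> norm_num
    set d : ℝ := ε * c.C 0 1 0 / b with hd_def
    have hd : ε * d * b = c.C 0 1 0 := by
      rw [hd_def]
      field_simp
      linear_combination c.C 0 1 0 * hεε
    -- `d` is the shear coefficient; `u`, `s` are the new `C_{22}{}^2`, `C_{12}{}^2`.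
    set u := c.C 1 1 1 / b + d * ε with hu
    set s := c.C 0 1 1 + d * (c.C 0 1 0 / b) - d * u with hs
    let c' : TypeBConstants :=
      { C := ![![![c.C 0 0 0 - d ^ 2 * ε, d * c.C 0 0 0 + b * c.C 0 0 1 - 2 * d * s - d ^ 2 * u],
            ![0, s]], ![![0, s], ![ε, u]]]
        symm := by
          intro i j k
          fin_cases i <;> fin_cases j <;> rfl }
    have hcc' : ∀ i j k, ∑ l, (!![1, 0; d, b] : Matrix (Fin 2) (Fin 2) ℝ) k l * c.C i j l
        = ∑ m, ∑ n, (!![1, 0; d, b] : Matrix (Fin 2) (Fin 2) ℝ) m i * !![1, 0; d, b] n j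
          * c'.C m n k := by
      have hub : b * u = c.C 1 1 1 + d * b * ε := by rw [hu]; field_simp
      have hsb : s = c.C 0 1 1 + d * (d * ε) - d * u := by rw [hs, ← hd]; field_simp
      intro i j k
      fin_cases i <;> fin_cases j <;> fin_cases k <;>
        simp [Fin.sum_univ_two, c.symm 1 0, c'] <;> grind
    have hu0 : u ≠ 0 := by
      intro hu0
      apply hw
      have : b * u = 0 := by rw [hu0, mul_zero]
      rw [hu] at this
      field_simp at this
      linarith
    exact ⟨c', linearlyEquivalent_of_forall hb hcc', Or.inr (familyTwo_of_isPowerExponent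
      ((isPowerExponent_iff_of_forall hb hcc').1 ha) hε rfl rfl hu0)⟩

theorem IsExceptional.exists_isPowerExponent {c : TypeBConstants} (h : c.IsExceptional) :
    ∃ a, c.IsPowerExponent a := by
  obtain ⟨c', hc, h⟩ := h
  suffices ∃ a, c'.IsPowerExponent a from by
    obtain ⟨a, b, hb, hcc'⟩ := hc.exists_forall
    exact this.imp fun e he => (isPowerExponent_iff_of_forall hb hcc').2 he
  simp only [isPowerExponent_iff, ricciSymConst_zero_zero, ricciSymConst_zero_one,
    ricciSymConst_one_one]
  rcases h with ⟨ht, hu, hr⟩ | ⟨ε, hε, ht, hr, hu, -, hp⟩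
  · refine ⟨c'.C 0 1 1, ?_, ?_, ?_⟩ <;> simp only [ht, hu] <;> ring
  · refine ⟨c'.C 0 0 0 - c'.C 0 1 1 - 1, ?_, ?_, ?_⟩ <;> simp only [hr, hu, ht, hp] <;> ring

/-! ### Integrability conditions -/

/-- Derivative of the right-hand side of the quasi-Einstein equation; `f`, `g` stand for the first
derivatives of the unknown `h`. -/
theorem partialDeriv_hessianForm {f g h : Plane → ℝ} {p : Plane} (hx : p 0 ≠ 0)
    (hf : DifferentiableAt ℝ f p) (hg : DifferentiableAt ℝ g p) (hh : DifferentiableAt ℝ h p)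
    (A B r : ℝ) (k : Fin 2) :
    partialDeriv k (fun q => (q 0)⁻¹ * A * f q + (q 0)⁻¹ * B * g q - (q 0 ^ 2)⁻¹ * r * h q) p
      = (p 0)⁻¹ * (A * partialDeriv k f p + B * partialDeriv k g p)
        - (p 0 ^ 2)⁻¹ * r * partialDeriv k h p
        + (if k = 0 then 2 * (p 0 ^ 3)⁻¹ * r * h p - (p 0 ^ 2)⁻¹ * (A * f p + B * g p) else 0) := by
  have hA := fun A : ℝ => hasDerivAt_inv_mul_const hx A
  have hr : HasDerivAt (fun y : ℝ => (y ^ 2)⁻¹ * r) (-2 * (p 0 ^ 3)⁻¹ * r) (p 0) :=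
    (((hasDerivAt_pow 2 (p 0)).inv (pow_ne_zero 2 hx)).mul_const r).congr_deriv (by
      push_cast
      field_simp)
  have dA := fun A : ℝ => differentiableAt_comp_coord_zero (hA A)
  have dr := differentiableAt_comp_coord_zero hr
  have h1 := partialDeriv_mul k (dA A) hf
  have h2 := partialDeriv_mul k (dA B) hg
  have h3 := partialDeriv_mul k dr hh
  rw [partialDeriv_comp_coord_zero (hA A)] at h1
  rw [partialDeriv_comp_coord_zero (hA B)] at h2
  rw [partialDeriv_comp_coord_zero hr] at h3
  have e : partialDeriv k
      (fun q => (q 0)⁻¹ * A * f q + (q 0)⁻¹ * B * g q - (q 0 ^ 2)⁻¹ * r * h q) p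
      = partialDeriv k (fun q => (q 0)⁻¹ * A * f q) p
        + partialDeriv k (fun q => (q 0)⁻¹ * B * g q) p
        - partialDeriv k (fun q => (q 0 ^ 2)⁻¹ * r * h q) p := by
    have e := (((dA A).mul hf).hasFDerivAt.add ((dA B).mul hg).hasFDerivAt).sub
      (dr.mul hh).hasFDerivAt
    exact congrArg (fun L => L (Pi.single k 1)) e.fderiv
  rw [e, h1, h2, h3]
  split_ifs <;> ring

variable {c : TypeBConstants} {U : TopologicalSpace.Opens Plane}

/-- `f` is a smooth solution on `U` of the quasi-Einstein equation of the Type B connection with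
`μ = -1`, solved for the second derivatives. -/
def IsSolutionOn (c : TypeBConstants) (U : TopologicalSpace.Opens Plane) (f : Plane → ℝ) : Prop :=
  ContDiffOn ℝ ∞ f U ∧ ∀ p ∈ U, ∀ i j, partialDeriv i (partialDeriv j f) p
    = (p 0)⁻¹ * c.C i j 0 * partialDeriv 0 f p + (p 0)⁻¹ * c.C i j 1 * partialDeriv 1 f p
      - (p 0 ^ 2)⁻¹ * c.ricciSymConst i j * f p

theorem mem_E_iff_isSolutionOn (hU : U ≤ halfPlane) (f : U → ℝ) :
    f ∈ (c.connection U hU).E (-1) ↔ c.IsSolutionOn U (extendZero f) := by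
  refine and_congr_right fun _ => forall₂_congr fun p hp => forall₂_congr fun i j => ?_
  rw [ricciSym_connection c U hU hp]
  simp only [Connection.hessian, connection, Fin.sum_univ_two]
  constructor <;> intro h <;> linear_combination h

theorem IsSolutionOn.congr {f g : Plane → ℝ} (hf : c.IsSolutionOn U f)
    (h : ∀ p ∈ U, g p = f p) : c.IsSolutionOn U g := by
  refine ⟨hf.1.congr h, fun p hp i j => ?_⟩
  rw [partialDeriv_congr (fun q hq => partialDeriv_congr h j hq) i hp, partialDeriv_congr h 0 hp,
    partialDeriv_congr h 1 hp, h p hp, hf.2 p hp]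

/-- The integrability condition of the quasi-Einstein equation, obtained from
`∂_1 ∂_2 (∂_i f) = ∂_2 ∂_1 (∂_i f)`. For `μ = -1` the only curvature term in front of the first
derivatives is the skew part of the Ricci tensor. -/
theorem IsSolutionOn.skew_mul_partialDeriv {f : Plane → ℝ} (hf : c.IsSolutionOn U f)
    (hU : U ≤ halfPlane) {p : Plane} (hp : p ∈ U) (i : Fin 2) :
    (c.C 0 1 0 + c.C 1 1 1) / 2 * p 0 * partialDeriv i f p = c.codazziConst i * f p := by
  obtain ⟨hs, hf⟩ := hf
  have hx : p 0 ≠ 0 := ne_of_gt (hU hp)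
  have hd := fun i => differentiableAt_of_smooth (smooth_partialDeriv hs i) hp
  have e : ∀ k i j, partialDeriv k (partialDeriv i (partialDeriv j f)) p = _ := fun k i j =>
    (partialDeriv_congr (fun q hq => hf q hq i j) k hp).trans
      (partialDeriv_hessianForm hx (hd 0) (hd 1) (differentiableAt_of_smooth hs hp) _ _ _ k)
  have hc := partialDeriv_comm (smooth_partialDeriv hs i) hp 0 1
  rw [e, e] at hc
  simp only [hf p hp] at hc
  fin_cases i
  · simp [codazziConst, Fin.sum_univ_two, c.symm 1 0, c.ricciSymConst_comm 1 0,
      ricciSymConst_zero_zero, ricciSymConst_zero_one, ricciSymConst_one_one] at hc ⊢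
    field_simp at hc
    linear_combination -hc / 2
  · simp [codazziConst, Fin.sum_univ_two, c.symm 1 0, c.ricciSymConst_comm 1 0,
      ricciSymConst_zero_zero, ricciSymConst_zero_one, ricciSymConst_one_one] at hc ⊢
    field_simp at hc
    linear_combination -hc / 2

theorem IsSolutionOn.codazziConst_eq_zero {f : Plane → ℝ} (hf : c.IsSolutionOn U f)
    (hU : U ≤ halfPlane) {p : Plane} (hp : p ∈ U) (hfp : f p ≠ 0)
    (hw : c.C 0 1 0 + c.C 1 1 1 = 0) (i : Fin 2) : c.codazziConst i = 0 := by
  have := hf.skew_mul_partialDeriv hU hp i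
  rw [hw, zero_div, zero_mul, zero_mul] at this
  exact (mul_eq_zero.1 this.symm).resolve_right hfp

theorem IsSolutionOn.partialDeriv_eq {f : Plane → ℝ} (hf : c.IsSolutionOn U f)
    (hU : U ≤ halfPlane) {p : Plane} (hp : p ∈ U) (hw : c.C 0 1 0 + c.C 1 1 1 ≠ 0) (i : Fin 2) :
    partialDeriv i f p
      = (p 0)⁻¹ * (2 * c.codazziConst i / (c.C 0 1 0 + c.C 1 1 1)) * f p := by
  have := hf.skew_mul_partialDeriv hU hp i
  have hx : p 0 ≠ 0 := ne_of_gt (hU hp)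
  field_simp
  linear_combination 2 * this

theorem IsSolutionOn.partialDeriv_partialDeriv_eq {f : Plane → ℝ} (hf : c.IsSolutionOn U f)
    (hU : U ≤ halfPlane) {p : Plane} (hp : p ∈ U) {a : Fin 2 → ℝ}
    (ha : ∀ q ∈ U, ∀ i, partialDeriv i f q = (q 0)⁻¹ * a i * f q) (i j : Fin 2) :
    partialDeriv i (partialDeriv j f) p
      = (p 0 ^ 2)⁻¹ * (a j * (a i - if i = 0 then 1 else 0)) * f p := by
  have hx : p 0 ≠ 0 := ne_of_gt (hU hp)
  have hA := hasDerivAt_inv_mul_const hx (a j)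
  rw [partialDeriv_congr (fun q hq => ha q hq j) i hp, partialDeriv_mul i
    (differentiableAt_comp_coord_zero hA) (differentiableAt_of_smooth hf.1 hp),
    partialDeriv_comp_coord_zero hA, ha p hp i]
  split_ifs <;> field_simp <;> ring

/-- If the logarithmic differential of a solution is `∑ i, a i dx^i / x^1`, its closedness gives
`a 1 = 0`, so the solution behaves like a power of `x^1`. -/
theorem IsSolutionOn.isPowerExponent {f : Plane → ℝ} (hf : c.IsSolutionOn U f)
    (hU : U ≤ halfPlane) {p : Plane} (hp : p ∈ U) (hfp : f p ≠ 0) {a : Fin 2 → ℝ}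
    (ha : ∀ q ∈ U, ∀ i, partialDeriv i f q = (q 0)⁻¹ * a i * f q) :
    a 1 = 0 ∧ c.IsPowerExponent (a 0) := by
  have hx : p 0 ≠ 0 := ne_of_gt (hU hp)
  have e := hf.partialDeriv_partialDeriv_eq hU hp ha
  have h1 : a 1 = 0 := by
    have := partialDeriv_comm hf.1 hp 0 1
    rw [e, e] at this
    simp only [if_true, one_ne_zero, if_false] at this
    field_simp at this
    linarith
  refine ⟨h1, fun i j => ?_⟩
  have h := hf.2 p hp i j
  rw [e, ha p hp 0, ha p hp 1, h1] at h
  have h' : a j * (a i - if i = 0 then 1 else 0) - c.C i j 0 * a 0 = -c.ricciSymConst i j := by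
    field_simp at h
    linear_combination h
  rw [← h']
  fin_cases i <;> fin_cases j <;> simp [h1]

/-! ### Power solutions -/

theorem isSolutionOn_rpow {a : ℝ} (ha : c.IsPowerExponent a) (hU : U ≤ halfPlane) :
    c.IsSolutionOn U fun p => p 0 ^ a := by
  have hs : ContDiffOn ℝ ∞ (fun p : Plane => p 0 ^ a) U :=
    (contDiff_apply ℝ ℝ (0 : Fin 2)).contDiffOn.rpow_const_of_ne fun p hp => ne_of_gt (hU hp)
  have h1 : ∀ a : ℝ, ∀ p ∈ U, ∀ i, partialDeriv i (fun p : Plane => p 0 ^ a) p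
      = if i = 0 then a * p 0 ^ (a - 1) else 0 := fun a p hp i =>
    partialDeriv_comp_coord_zero (Real.hasDerivAt_rpow_const (Or.inl (ne_of_gt (hU hp)))) i
  refine ⟨hs, fun p hp i j => ?_⟩
  have hx : 0 < p 0 := hU hp
  have h2 : partialDeriv i (partialDeriv j fun p : Plane => p 0 ^ a) p
      = if i = 0 ∧ j = 0 then a * ((a - 1) * p 0 ^ (a - 1 - 1)) else 0 := by
    rw [partialDeriv_congr (fun q hq => h1 a q hq j) i hp]
    by_cases hj : j = 0
    · have := partialDeriv_smul (p := p) (f := fun p : Plane => p 0 ^ (a - 1)) i a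
        (differentiableAt_comp_coord_zero
          (Real.hasDerivAt_rpow_const (Or.inl hx.ne')))
      rw [h1 _ p hp] at this
      simp only [hj, if_true, and_true]
      refine Eq.trans this ?_
      split_ifs <;> ring
    · simp [hj, partialDeriv]
  have h := ha i j
  rw [h2, h1 a p hp, h1 a p hp, Real.rpow_sub_one hx.ne', Real.rpow_sub_one hx.ne']
  have hh : c.ricciSymConst i j
      = c.C i j 0 * a - (if i = 0 ∧ j = 0 then a * (a - 1) else 0) := by linarith
  rw [hh]
  split_ifs <;> simp_all <;> field_simp <;> ring

/-- A function with `df = a f dx^1 / x^1` on a connected set is a multiple of `(x^1)^a`. -/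
theorem exists_eq_mul_rpow {f : Plane → ℝ} {a : ℝ} (hU : U ≤ halfPlane)
    (hconn : IsPreconnected (U : Set Plane)) (hs : ContDiffOn ℝ ∞ f U)
    (h : ∀ p ∈ U, ∀ i, partialDeriv i f p = if i = 0 then (p 0)⁻¹ * a * f p else 0) :
    ∃ k, ∀ p ∈ U, f p = k * p 0 ^ a := by
  have hne : ∀ p ∈ U, p 0 ≠ 0 := fun p hp => ne_of_gt (hU hp)
  have hd : ∀ p ∈ U, HasDerivAt (fun x : ℝ => x ^ (-a)) (-a * p 0 ^ (-a - 1)) (p 0) := fun p hp =>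
    Real.hasDerivAt_rpow_const (Or.inl (hne p hp))
  obtain ⟨k, hk⟩ := U.isOpen.exists_is_const_of_fderiv_eq_zero (𝕜 := ℝ)
    (f := fun p => p 0 ^ (-a) * f p) hconn (fun p hp =>
      ((differentiableAt_comp_coord_zero (hd p hp)).mul
        (differentiableAt_of_smooth hs hp)).differentiableWithinAt) (by
    intro p hp
    have hz : ∀ i, fderiv ℝ (fun p : Plane => p 0 ^ (-a) * f p) p (Pi.single i 1) = 0 := by
      intro i
      refine (partialDeriv_mul i (differentiableAt_comp_coord_zero (hd p hp))
        (differentiableAt_of_smooth hs hp)).trans ?_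
      rw [partialDeriv_comp_coord_zero (hd p hp), h p hp, Real.rpow_sub_one (hne p hp)]
      split_ifs <;> ring
    refine ContinuousLinearMap.coe_injective (LinearMap.pi_ext' fun i => ?_)
    ext
    simpa using hz i)
  refine ⟨k, fun p hp => ?_⟩
  have hx : 0 < p 0 := hU hp
  rw [← hk p hp, mul_comm, ← mul_assoc, ← Real.rpow_add hx]
  simp

/-! ### The dimension of the solution space -/

theorem extendZero_coe {U : TopologicalSpace.Opens Plane} (f : U → ℝ) (p : U) :
    extendZero f p = f p := by
  simp [extendZero]

theorem rank_E_eq_one {c : TypeBConstants} {U : TopologicalSpace.Opens Plane} (hU : U ≤ halfPlane)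
    (hconn : IsConnected (U : Set Plane))
    (hspf : ¬ (c.connection U hU).StronglyProjectivelyFlat) (hex : c.IsExceptional) :
    Module.rank ℝ ((c.connection U hU).E (-1)) = 1 := by
  obtain ⟨a, ha⟩ := hex.exists_isPowerExponent
  have hw : c.C 0 1 0 + c.C 1 1 1 ≠ 0 := fun hw =>
    hspf (stronglyProjectivelyFlat_of_isPowerExponent ha hw U hU)
  obtain ⟨p₀, hp₀⟩ := hconn.nonempty
  -- All solutions have the same logarithmic derivatives, namely those of the power solution.
  obtain ⟨h1, hb⟩ := (isSolutionOn_rpow ha hU).isPowerExponent hU hp₀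
    (Real.rpow_pos_of_pos (hU hp₀) a).ne'
    fun q hq i => (isSolutionOn_rpow ha hU).partialDeriv_eq hU hq hw i
  set b := 2 * c.codazziConst 0 / (c.C 0 1 0 + c.C 1 1 1)
  let g : U → ℝ := fun p => p.1 0 ^ b
  have hg : g ∈ (c.connection U hU).E (-1) := (mem_E_iff_isSolutionOn hU g).2
    ((isSolutionOn_rpow hb hU).congr fun p hp => extendZero_coe g ⟨p, hp⟩)
  refine rank_eq_one (⟨g, hg⟩ : (c.connection U hU).E (-1)) ?_ ?_
  · intro h
    rw [Submodule.mk_eq_zero] at h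
    exact (Real.rpow_pos_of_pos (hU hp₀) b).ne' (congrFun h ⟨p₀, hp₀⟩)
  · rintro ⟨f, hf⟩
    have hf' := (mem_E_iff_isSolutionOn hU f).1 hf
    obtain ⟨k, hk⟩ := exists_eq_mul_rpow (a := b) hU hconn.isPreconnected hf'.1 fun p hp i => by
      rw [hf'.partialDeriv_eq hU hp hw i]
      fin_cases i
      · simp [b]
      · simp [h1]
    refine ⟨k, Subtype.ext (funext fun p => ?_)⟩
    exact ((extendZero_coe f p).symm.trans (hk p p.2)).symm

theorem rank_E_eq_zero {c : TypeBConstants} {U : TopologicalSpace.Opens Plane} (hU : U ≤ halfPlane)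
    (hspf : ¬ (c.connection U hU).StronglyProjectivelyFlat) (hex : ¬ c.IsExceptional) :
    Module.rank ℝ ((c.connection U hU).E (-1)) = 0 := by
  rw [rank_zero_iff_forall_zero]
  rintro ⟨f, hf⟩
  rw [mem_E_iff_isSolutionOn] at hf
  rw [Submodule.mk_eq_zero]
  funext p
  by_contra hfp
  rw [Pi.zero_apply, ← extendZero_coe f] at hfp
  by_cases hw : c.C 0 1 0 + c.C 1 1 1 = 0
  · obtain ⟨a, ha⟩ := exists_isPowerExponent hw (hf.codazziConst_eq_zero hU p.2 hfp hw)
    exact hspf (stronglyProjectivelyFlat_of_isPowerExponent ha hw U hU)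
  · exact hex (isExceptional_of_isPowerExponent (hf.isPowerExponent hU p.2 hfp
      fun q hq i => hf.partialDeriv_eq hU hq hw i).2 hw)

end TypeBConstants

end AffineSurface

end

theorem theorem1p15 (c : AffineSurface.TypeBConstants)
    (U : TopologicalSpace.Opens AffineSurface.Plane) (hU : U ≤ AffineSurface.halfPlane)
    (hconn : IsConnected (U : Set AffineSurface.Plane))
    (hρ : (c.connection U hU).RicciNeZero)
    (hspf : ¬ (c.connection U hU).StronglyProjectivelyFlat) :
    (c.IsExceptional → Module.rank ℝ ((c.connection U hU).E (-1)) = 1) ∧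
    (¬ c.IsExceptional → Module.rank ℝ ((c.connection U hU).E (-1)) = 0) :=
  ⟨AffineSurface.TypeBConstants.rank_E_eq_one hU hconn hspf,
    AffineSurface.TypeBConstants.rank_E_eq_zero hU hspf⟩
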